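/- Let $\Sigma$ be a finite nonempty alphabet. An alternating automaton is $\mathcal A=(\Sigma,Q,\iota,\delta,\alpha)$ with a finite set $Q$ of states, $\iota\in Q$, $\delta:Q\times\Sigma\to B^+(Q)$, where $B^+(Q)$ is the set of positive boolean formulas built from the elements of $Q$ with $\wedge$ and $\vee$, and $\alpha\subseteq Q$. It is deterministic if all values of $\delta$ are states. In the model-checking game of $\mathcal A$ on a word $w$, a play starts in the state $\iota$; from a state $q$ the next letter $a$ of $w$ is read and the play moves to $\delta(q,a)$; from $b\wedge b'$ Adam, and from $b\vee b'$ Eve, chooses one of $b,b'$ to continue with. If $w$ is finite, Eve wins when the state reached after reading all of $w$ is in $\alpha$; if $w$ is infinite, Eve wins when the play visits $\alpha$ infinitely often (Büchi condition). The language $L(\mathcal A)$ is the set of (finite, respectively infinite) words on which Eve has a winning strategy; two automata are equivalent if they have the same language. An automaton on finite words is called an AFA (a DFA if it is deterministic). An automaton on infinite words is called an AWW (a DWW if it is deterministic) if it is weak: in the graph on $Q$ with an edge $q\to q'$ whenever $q'$ occurs in $\delta(q,a)$ for some $a\in\Sigma$, every strongly connected component is contained in $\alpha$ or disjoint from $\alpha$.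 $\mathcal A$ is good for games (GFG), in the form of history-determinism, if there are functions $\tau_E,\tau_A:(\Sigma\times B^+(Q))^*\to B^+(Q)$, which see only the letters read so far and the transition conditions visited so far, such that $\tau_E$ is a winning strategy for Eve in the model-checking game on every $w\in L(\mathcal A)$, and $\tau_A$ is a winning strategy for Adam in the model-checking game on every $w\notin L(\mathcal A)$. **Theorem.** For every GFG AFA $\mathcal A$ there is an equivalent DFA, and for every GFG AWW $\mathcal A$ there is an equivalent DWW, whose number of states is not more than that of $\mathcal A$. -/

import Mathlib

/-- Positive boolean formulas (transition conditions) over a set `Q` of states. -/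
inductive PosForm (Q : Type*) where
  | state (q : Q) : PosForm Q
  | conj (b c : PosForm Q) : PosForm Q
  | disj (b c : PosForm Q) : PosForm Q

namespace PosForm

/-- The states that occur in a transition condition. -/
def states {Q : Type*} : PosForm Q → Set Q
  | state q => {q}
  | conj b c => b.states ∪ c.states
  | disj b c => b.states ∪ c.states

end PosForm

/-! ### Two-player games -/

inductive Player where
  | eve
  | adam

/-- A rooted two-player game of infinite duration; `eveWins` is the set of plays won by Eve,
all other plays are won by Adam. -/
structure Game (V : Type*) where
  init : V
  owner : V → Player
  Move : V → V → Prop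
  eveWins : Set (ℕ → V)

namespace Game

variable {V : Type*} (G : Game V)

/-- A play is an infinite path from the root. -/
def IsPlay (π : ℕ → V) : Prop :=
  π 0 = G.init ∧ ∀ k, G.Move (π k) (π (k + 1))

/-- The positions of a play strictly before time `k`. -/
def past (π : ℕ → V) (k : ℕ) : List V :=
  (List.range k).map π

/-- The play is won by the given player. -/
def WonBy : Player → (ℕ → V) → Prop
  | .eve, π => π ∈ G.eveWins
  | .adam, π => π ∉ G.eveWins

/-- `s` is a strategy for `p`: given a history of a play, split into the past and the current
position, it picks a legal move whenever the current position belongs to `p`. -/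
def IsStrategy (p : Player) (s : List V → V → V) : Prop :=
  ∀ π, G.IsPlay π → ∀ k, G.owner (π k) = p → G.Move (π k) (s (past π k) (π k))

/-- The play `π` agrees with the strategy `s` of the player `p`. -/
def Agrees (p : Player) (s : List V → V → V) (π : ℕ → V) : Prop :=
  ∀ k, G.owner (π k) = p → π (k + 1) = s (past π k) (π k)

/-- `s` is a winning strategy (from the root) for the player `p`. -/
def IsWinning (p : Player) (s : List V → V → V) : Prop :=
  G.IsStrategy p s ∧ ∀ π, G.IsPlay π → G.Agrees p s π → G.WonBy p π

/-- The player `p` wins the game. -/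
def Wins (p : Player) : Prop :=
  ∃ s, G.IsWinning p s

end Game

/-! ### Alternating automata -/

/-- An alternating automaton over the alphabet `α` with states `Q`, whose acceptance condition is
a set of states: the final states on finite words, the Büchi accepting states on infinite words. -/
structure AltAutomaton (α Q : Type*) where
  init : Q
  δ : Q → α → PosForm Q
  acc : Set Q

namespace AltAutomaton

variable {α Q : Type*} (A : AltAutomaton α Q)

/-- All transition conditions are states. -/
def IsDeterministic : Prop :=
  ∀ q a, ∃ q', A.δ q a = PosForm.state q'

/-- The graph on the states that is induced by the transition function. -/
def Edge (q q' : Q) : Prop :=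
  ∃ a, q' ∈ (A.δ q a).states

/-- Weakness: every strongly connected component consists only of accepting or only of rejecting
states. -/
def IsWeak : Prop :=
  ∀ q q', Relation.ReflTransGen A.Edge q q' → Relation.ReflTransGen A.Edge q' q →
    (q ∈ A.acc ↔ q' ∈ A.acc)

/-! #### The model-checking game

A finite or infinite word is given by its letters `ℓ : ℕ → Option α`, with `ℓ i = none` beyond the
end of a finite word. A position `(i, b)` of the game means that `i` letters have been read and
that `b` is the current transition condition. A play starts in `(0, init)`. -/

/-- The position after `(i, q)`: the next letter is read; if there is none, the play stays put. -/
def next (ℓ : ℕ → Option α) (i : ℕ) (q : Q) : ℕ × PosForm Q :=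
  match ℓ i with
  | some a => (i + 1, A.δ q a)
  | none => (i, PosForm.state q)

/-- Moves of the model-checking game. -/
def MCMove (ℓ : ℕ → Option α) : ℕ × PosForm Q → ℕ × PosForm Q → Prop
  | (i, .state q), v => v = A.next ℓ i q
  | (i, .conj b c), v => v = (i, b) ∨ v = (i, c)
  | (i, .disj b c), v => v = (i, b) ∨ v = (i, c)

/-- Adam resolves conjunctions and Eve resolves disjunctions. Positions whose condition is a state
have exactly one successor; they are given to Eve, which does not matter. -/
def mcOwner : ℕ × PosForm Q → Player
  | (_, .state _) => .eve
  | (_, .conj _ _) => .adam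
  | (_, .disj _ _) => .eve

/-- The model-checking game on a word, with the given set of plays won by Eve. -/
def mcGame (ℓ : ℕ → Option α) (W : Set (ℕ → ℕ × PosForm Q)) : Game (ℕ × PosForm Q) where
  init := (0, PosForm.state A.init)
  owner := mcOwner
  Move := A.MCMove ℓ
  eveWins := W

/-- On a finite word, Eve wins if the state reached after reading the whole word is final. -/
def finGame (u : List α) : Game (ℕ × PosForm Q) :=
  A.mcGame (fun i => u[i]?) {π | ∃ k, ∃ q ∈ A.acc, π k = (u.length, PosForm.state q)}

/-- On an infinite word, Eve wins if accepting states are visited infinitely often. -/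
def infGame (w : ℕ → α) : Game (ℕ × PosForm Q) :=
  A.mcGame (fun i => some (w i))
    {π | ∃ᶠ k in Filter.atTop, ∃ i, ∃ q ∈ A.acc, π k = (i, PosForm.state q)}

/-- The language of finite words recognized by `A`. -/
def finLanguage : Language α :=
  {u : List α | (A.finGame u).Wins .eve}

/-- The language of infinite words recognized by `A`. -/
def infLanguage : Set (ℕ → α) :=
  {w | (A.infGame w).Wins .eve}

/-! #### Good-for-games automata (history-determinism) -/

/-- A position of the model-checking game as it is seen by a history-deterministic strategy: the
last letter read and the transition condition. The initial position, before the first letter, is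
not recorded. -/
def observe (ℓ : ℕ → Option α) : ℕ × PosForm Q → Option (α × PosForm Q)
  | (0, _) => none
  | (i + 1, b) => (ℓ i).map fun a => (a, b)

/-- The use of a function `τ : (α × B⁺(Q))* → B⁺(Q)`, which sees only the letters read so far and
the transition conditions visited so far, as a strategy in the model-checking game on a word. If
the current condition is a state, the unique move is made. -/
def extend (ℓ : ℕ → Option α) (τ : List (α × PosForm Q) → PosForm Q)
    (h : List (ℕ × PosForm Q)) : ℕ × PosForm Q → ℕ × PosForm Q
  | (i, .state q) => A.next ℓ i q
  | (i, .conj b c) => (i, τ ((h ++ [(i, PosForm.conj b c)]).filterMap (observe ℓ)))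
  | (i, .disj b c) => (i, τ ((h ++ [(i, PosForm.disj b c)]).filterMap (observe ℓ)))

/-- `A` is good for games as an automaton on finite words: both its nondeterminism and its
universality are history-deterministic. -/
def FinGFG : Prop :=
  (∃ τ : List (α × PosForm Q) → PosForm Q, ∀ u : List α, u ∈ A.finLanguage →
    (A.finGame u).IsWinning .eve (A.extend (fun i => u[i]?) τ)) ∧
  (∃ τ : List (α × PosForm Q) → PosForm Q, ∀ u : List α, u ∉ A.finLanguage →
    (A.finGame u).IsWinning .adam (A.extend (fun i => u[i]?) τ))

/-- `A` is good for games as a Büchi automaton on infinite words: both its nondeterminism and its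
universality are history-deterministic. -/
def InfGFG : Prop :=
  (∃ τ : List (α × PosForm Q) → PosForm Q, ∀ w : ℕ → α, w ∈ A.infLanguage →
    (A.infGame w).IsWinning .eve (A.extend (fun i => some (w i)) τ)) ∧
  (∃ τ : List (α × PosForm Q) → PosForm Q, ∀ w : ℕ → α, w ∉ A.infLanguage →
    (A.infGame w).IsWinning .adam (A.extend (fun i => some (w i)) τ))

end AltAutomaton

/-!
On a finite word, let the history-deterministic strategies of Eve and Adam play against each other.
Suppose that this leads to the same state after `u` and after `u'`, that `uv` belongs to the
language, and that `u'v` does not. From this state on, let Eve continue on `v` with her memory of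
`u`, and Adam with his memory of `u'`. The play that results is the continuation both of a play on
`uv` that Eve wins and of a play on `u'v` that Adam wins, which is impossible. So the state
determines the residual language, and there are at most as many residual languages as states.

On infinite words the residual languages are again the states of the deterministic automaton. In
each of its strongly connected components, choose a word `u` leading to it for which the state of
`A` reached by the two strategies is as far as possible in the graph of `A`. While the residual
languages stay in the component, the state of `A` cannot leave its own component. Because `A` is
weak, a word whose residual languages end up in the component is therefore accepted if and only if
the state after `u` is accepting.
-/

open Filter Relation

/-! ### Preorders, iteration, and finite transition systems -/

theorem exists_mem_forall_rel_symm {ι X : Type*} [Finite X] (r : X → X → Prop) [IsPreorder X r]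
    (f : ι → X) {T : Set ι} (hT : T.Nonempty) :
    ∃ i ∈ T, ∀ j ∈ T, r (f i) (f j) → r (f j) (f i) := by
  obtain ⟨i, hi, hmin⟩ :=
    exists_minimalFor_of_wellFoundedLT (· ∈ T) (fun i => {x | r (f i) x}) hT
  exact ⟨i, hi, fun j hj hij => hmin hj (fun _ hx => _root_.trans hij hx) (refl (f i))⟩

theorem exists_seq_of_iterate_of_rel {X : Type*} (F : X → X) (r : X → X → Prop) [Std.Refl r]
    {x y : X} {t : ℕ} (h : r (F^[t] x) y) :
    ∃ f : ℕ → X, r x (f 0) ∧ (∀ k, r (F (f k)) (f (k + 1))) ∧ ∀ k, f (t + k) = F^[k] y := by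
  refine ⟨fun k => if k < t then F^[k] x else F^[k - t] y, ?_, fun k => ?_, fun k => by simp⟩
  · obtain rfl | ht := t.eq_zero_or_pos
    · exact h
    · simpa [ht] using refl x
  · obtain hk | rfl | hk := lt_trichotomy (k + 1) t
    · simpa [hk, (Nat.lt_succ_self k).trans hk, Function.iterate_succ_apply'] using refl _
    · simpa [Function.iterate_succ_apply'] using h
    · have ht : t ≤ k := Nat.lt_succ_iff.1 hk
      simpa [ht.not_gt, hk.not_gt, Nat.succ_sub ht, Function.iterate_succ_apply'] using refl _

theorem exists_fin_foldl_eq {α Q X : Type*} [Fintype Q] (f : X → α → X) (res : List α → X)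
    (hres : ∀ u a, res (u ++ [a]) = f (res u) a) (q : List α → Q)
    (hq : ∀ u v, q u = q v → res u = res v) :
    ∃ n ≤ Fintype.card Q, ∃ (s₀ : Fin n) (d : Fin n → α → Fin n) (r : Fin n → X),
      ∀ u : List α, r (u.foldl d s₀) = res u := by
  choose rep hrep using fun x : Set.range res => x.2
  have hinj : Function.Injective (q ∘ rep) := fun x y h =>
    Subtype.ext <| by rw [← hrep x, ← hrep y, hq _ _ h]
  have := Finite.of_injective _ hinj
  have := Fintype.ofFinite (Set.range res)
  let e := Fintype.equivFin (Set.range res)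
  have hstep (x : Set.range res) (a : α) : f x a ∈ Set.range res :=
    ⟨rep x ++ [a], by rw [hres, hrep]⟩
  refine ⟨_, Fintype.card_le_of_injective _ hinj, e ⟨res [], [], rfl⟩,
    fun s a => e ⟨f (e.symm s) a, hstep _ a⟩, fun s => e.symm s, fun u => ?_⟩
  induction u using List.reverseRecOn with
  | nil => simp
  | append_singleton u a ih => simp [ih, hres]

namespace Game

variable {V : Type*} {G : Game V}

theorem past_succ (π : ℕ → V) (k : ℕ) : past π (k + 1) = past π k ++ [π k] := by
  simp [past, List.range_succ]

theorem wonBy_iff {p : Player} {π : ℕ → V} : G.WonBy p π ↔ (π ∈ G.eveWins ↔ p = .eve) := by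
  cases p <;> simp [WonBy]

theorem wins_iff_of_move_iff {π : ℕ → V} (h0 : π 0 = G.init)
    (hπ : ∀ k v, G.Move (π k) v ↔ v = π (k + 1)) (p : Player) : G.Wins p ↔ G.WonBy p π := by
  have hplay : G.IsPlay π := ⟨h0, fun k => (hπ k _).2 rfl⟩
  have hunique : ∀ π', G.IsPlay π' → π' = π := fun π' h => funext fun k => by
    induction k with
    | zero => rw [h.1, h0]
    | succ k ih => exact (hπ k _).1 (ih ▸ h.2 k)
  constructor
  · rintro ⟨s, hs, hwin⟩
    exact hwin π hplay fun k hk => ((hπ k _).1 (hs π hplay k hk)).symm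
  · refine fun h => ⟨fun past _ => π (past.length + 1), fun π' hπ' k _ => ?_, fun π' hπ' _ => ?_⟩
    · obtain rfl := hunique π' hπ'
      simpa [past] using hπ'.2 k
    · rwa [hunique π' hπ']

end Game

namespace AltAutomaton

variable {α Q : Type*} {A : AltAutomaton α Q}

/-! ### States visited by a play -/

section

variable {ℓ : ℕ → Option α} {π : ℕ → ℕ × PosForm Q}

theorem fst_le_of_mcMove {v v' : ℕ × PosForm Q} (h : A.MCMove ℓ v v') : v.1 ≤ v'.1 := by
  obtain ⟨i, q | _ | _⟩ := v
  · obtain rfl : v' = A.next ℓ i q := h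
    unfold next
    split <;> simp
  all_goals rcases h with rfl | rfl <;> rfl

theorem monotone_fst_of_mcMove (hπ : ∀ k, A.MCMove ℓ (π k) (π (k + 1))) :
    Monotone fun k => (π k).1 :=
  monotone_nat_of_le_succ fun k => fst_le_of_mcMove (hπ k)

theorem lt_fst_or_eq_of_state (hπ : ∀ k, A.MCMove ℓ (π k) (π (k + 1))) {k k' i : ℕ} {q : Q}
    (hk : π k = (i, .state q)) (hkk' : k ≤ k') : i < (π k').1 ∨ π k' = (i, .state q) := by
  induction k', hkk' using Nat.le_induction with
  | base => exact .inr hk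
  | succ k' _ ih =>
    obtain hlt | heq := ih
    · exact .inl (hlt.trans_le (fst_le_of_mcMove (hπ k')))
    · have hmove : π (k' + 1) = A.next ℓ i q := by simpa only [heq, MCMove] using hπ k'
      rw [hmove, next]
      split <;> simp

theorem state_unique (hπ : ∀ k, A.MCMove ℓ (π k) (π (k + 1))) {k k' i : ℕ} {q q' : Q}
    (hk : π k = (i, .state q)) (hk' : π k' = (i, .state q')) : q = q' := by
  wlog hkk' : k ≤ k' generalizing k k' q q'
  · exact (this hk' hk (le_of_not_ge hkk')).symm
  · simpa [hk', eq_comm] using lt_fst_or_eq_of_state hπ hk hkk'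

theorem frequently_mem_acc_iff_of_visits (hπ : ∀ k, A.MCMove ℓ (π k) (π (k + 1))) {m : ℕ}
    {s : ℕ → Q} (hs : ∀ n, ∃ k, π k = (m + n, .state (s n))) :
    (∃ᶠ k in atTop, ∃ i, ∃ q ∈ A.acc, π k = (i, .state q)) ↔ ∃ᶠ n in atTop, s n ∈ A.acc := by
  simp only [frequently_atTop]
  constructor
  · intro h N
    obtain ⟨t, ht⟩ := hs N
    obtain ⟨k, hk, i, q, hq, hki⟩ := h t
    have hle : m + N ≤ i := by simpa [ht, hki] using monotone_fst_of_mcMove hπ hk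
    obtain ⟨n, rfl⟩ := Nat.exists_eq_add_of_le ((Nat.le_add_right m N).trans hle)
    obtain ⟨t', ht'⟩ := hs n
    exact ⟨n, by omega, state_unique hπ ht' hki ▸ hq⟩
  · intro h K
    obtain ⟨n, hn, hacc⟩ := h ((π K).1 + 1)
    obtain ⟨k, hk⟩ := hs n
    refine ⟨k, ((monotone_fst_of_mcMove hπ).reflect_lt ?_).le, _, _, hacc, hk⟩
    simp only [hk]
    omega

end

/-! ### The two strategies played against each other -/

/-- The observations of each player. The memories of both players agree in a play from the root;
they are kept apart so that players with different pasts can meet. -/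
abbrev Memory (α Q : Type*) := Player → List (α × PosForm Q)

namespace Memory

/-- Append the observations `o` to the memories of both players. -/
def record (m : Memory α Q) (o : List (α × PosForm Q)) : Memory α Q :=
  fun p => m p ++ o

/-- The memory in which Adam remembers `m'` and Eve remembers `m`. -/
def mix (m m' : Memory α Q) : Memory α Q
  | .eve => m .eve
  | .adam => m' .adam

end Memory

open Classical in
/-- The operand of a conjunction or disjunction of `b` and `c` that is chosen by the proposal `d`.
Illegal proposals default to `b`, so that strategies that are not winning can be followed too. -/
noncomputable def select (d b c : PosForm Q) : PosForm Q :=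
  if d = c then c else b

theorem select_induction {motive : PosForm Q → Prop} {b c : PosForm Q} (hb : motive b)
    (hc : motive c) (d : PosForm Q) : motive (select d b c) := by
  unfold select
  split
  exacts [hc, hb]

theorem select_eq_self {d b c : PosForm Q} (h : d = b ∨ d = c) : select d b c = d := by
  unfold select
  split <;> simp_all

section

variable (τ : Player → List (α × PosForm Q) → PosForm Q)

open Classical in
/-- The memories and the state after the transition condition reached by reading `a` has been
resolved by both players following `τ`. Unfolding `select` makes the recursion structural. -/
noncomputable def resolve (a : α) : PosForm Q → Memory α Q → Memory α Q × Q
  | .state q, m => (m, q)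
  | .conj b c, m =>
    if τ .adam (m .adam) = c then resolve a c (m.record [(a, c)])
    else resolve a b (m.record [(a, b)])
  | .disj b c, m =>
    if τ .eve (m .eve) = c then resolve a c (m.record [(a, c)])
    else resolve a b (m.record [(a, b)])

theorem resolve_conj (a : α) (b c : PosForm Q) (m : Memory α Q) :
    resolve τ a (.conj b c) m = resolve τ a (select (τ .adam (m .adam)) b c)
      (m.record [(a, select (τ .adam (m .adam)) b c)]) := by
  rw [resolve, select]
  split <;> rfl

theorem resolve_disj (a : α) (b c : PosForm Q) (m : Memory α Q) :
    resolve τ a (.disj b c) m = resolve τ a (select (τ .eve (m .eve)) b c)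
      (m.record [(a, select (τ .eve (m .eve)) b c)]) := by
  rw [resolve, select]
  split <;> rfl

theorem resolve_mem_states (a : α) (b : PosForm Q) (m : Memory α Q) :
    (resolve τ a b m).2 ∈ b.states := by
  induction b generalizing m with
  | state q => rfl
  | conj b c hb hc =>
    rw [resolve_conj]
    exact select_induction (motive := fun d => ∀ m, (resolve τ a d m).2 ∈ b.states ∪ c.states)
      (fun m => .inl (hb m)) (fun m => .inr (hc m)) _ _
  | disj b c hb hc =>
    rw [resolve_disj]
    exact select_induction (motive := fun d => ∀ m, (resolve τ a d m).2 ∈ b.states ∪ c.states)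
      (fun m => .inl (hb m)) (fun m => .inr (hc m)) _ _

variable (A)

/-- The memories and the state after one more letter. -/
noncomputable def stepLetter (x : Memory α Q × Q) (a : α) : Memory α Q × Q :=
  resolve τ a (A.δ x.2 a) (x.1.record [(a, A.δ x.2 a)])

/-- The memories and the state after reading a word from `x`, with both players following `τ`. -/
noncomputable def run (x : Memory α Q × Q) (u : List α) : Memory α Q × Q :=
  u.foldl (A.stepLetter τ) x

/-- The run from the initial state without prior observations. -/
noncomputable def mainRun (u : List α) : Memory α Q × Q :=
  A.run τ (fun _ => [], A.init) u

theorem run_append (x : Memory α Q × Q) (u v : List α) :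
    A.run τ x (u ++ v) = A.run τ (A.run τ x u) v :=
  List.foldl_append

theorem mainRun_append (u v : List α) : A.mainRun τ (u ++ v) = A.run τ (A.mainRun τ u) v :=
  A.run_append τ _ u v

theorem reflTransGen_edge_run (x : Memory α Q × Q) (u : List α) :
    ReflTransGen A.Edge x.2 (A.run τ x u).2 := by
  induction u generalizing x with
  | nil => exact .refl
  | cons a u ih => exact .head ⟨a, resolve_mem_states τ a _ _⟩ (ih (A.stepLetter τ x a))

/-! ### The joint run as a play -/

/-- The position after `v` in a play of the model-checking game in which both players follow `τ`
with memories `m`. -/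
noncomputable def jointMove (ℓ : ℕ → Option α) (m : Memory α Q) :
    ℕ × PosForm Q → ℕ × PosForm Q
  | (i, .state q) => A.next ℓ i q
  | (i, .conj b c) => (i, select (τ .adam (m .adam)) b c)
  | (i, .disj b c) => (i, select (τ .eve (m .eve)) b c)

/-- One step of the joint play, in which both players record what they observe. -/
noncomputable def advance (ℓ : ℕ → Option α) (x : Memory α Q × (ℕ × PosForm Q)) :
    Memory α Q × (ℕ × PosForm Q) :=
  (x.1.record (observe ℓ (A.jointMove τ ℓ x.1 x.2)).toList, A.jointMove τ ℓ x.1 x.2)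

/-- The word `ℓ` continues with the letters of `v` from index `i` on. -/
def Reads (ℓ : ℕ → Option α) (i : ℕ) (v : List α) : Prop :=
  ∀ k a, v[k]? = some a → ℓ (i + k) = some a

/-- The configuration `x` of a run, seen as a stage of the joint play after `i` letters. -/
def atState (i : ℕ) (x : Memory α Q × Q) : Memory α Q × (ℕ × PosForm Q) :=
  (x.1, i, .state x.2)

theorem mcMove_jointMove (ℓ : ℕ → Option α) (m : Memory α Q) (v : ℕ × PosForm Q) :
    A.MCMove ℓ v (A.jointMove τ ℓ m v) := by
  obtain ⟨i, q | ⟨b, c⟩ | ⟨b, c⟩⟩ := v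
  · rfl
  all_goals
    exact select_induction (motive := fun d => (i, d) = (i, b) ∨ (i, d) = (i, c))
      (.inl rfl) (.inr rfl) _

variable {A τ}

theorem jointMove_eq_extend {ℓ : ℕ → Option α} {m : Memory α Q} {h : List (ℕ × PosForm Q)}
    {v : ℕ × PosForm Q} (hm : m (mcOwner v) = (h ++ [v]).filterMap (observe ℓ))
    (hlegal : A.MCMove ℓ v (A.extend ℓ (τ (mcOwner v)) h v)) :
    A.jointMove τ ℓ m v = A.extend ℓ (τ (mcOwner v)) h v := by
  obtain ⟨i, q | ⟨b, c⟩ | ⟨b, c⟩⟩ := v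
  · rfl
  all_goals
    simp only [mcOwner] at hm
    simp only [jointMove, extend, mcOwner, MCMove, hm, Prod.mk.injEq, true_and] at hlegal ⊢
    exact select_eq_self hlegal

theorem exists_iterate_advance_resolve {ℓ : ℕ → Option α} {i : ℕ} {a : α} (ha : ℓ i = some a)
    (b : PosForm Q) (m : Memory α Q) :
    ∃ t, (A.advance τ ℓ)^[t] (m, i + 1, b) = atState (i + 1) (resolve τ a b m) := by
  have hstep {b d : PosForm Q} {m : Memory α Q} (hd : A.jointMove τ ℓ m (i + 1, b) = (i + 1, d)) :
      A.advance τ ℓ (m, i + 1, b) = (m.record [(a, d)], i + 1, d) := by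
    simp [advance, hd, observe, ha]
  let Resolves (b : PosForm Q) : Prop :=
    ∀ m, ∃ t, (A.advance τ ℓ)^[t] (m, i + 1, b) = atState (i + 1) (resolve τ a b m)
  induction b generalizing m with
  | state q => exact ⟨0, rfl⟩
  | conj b c hb hc =>
    obtain ⟨t, ht⟩ := select_induction (motive := Resolves) hb hc (τ .adam (m .adam)) _
    exact ⟨t + 1, by rw [Function.iterate_succ_apply, hstep rfl, ht, resolve_conj]⟩
  | disj b c hb hc =>
    obtain ⟨t, ht⟩ := select_induction (motive := Resolves) hb hc (τ .eve (m .eve)) _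
    exact ⟨t + 1, by rw [Function.iterate_succ_apply, hstep rfl, ht, resolve_disj]⟩

theorem exists_iterate_advance_run {ℓ : ℕ → Option α} {i : ℕ} {v : List α} (hv : Reads ℓ i v)
    (x : Memory α Q × Q) :
    ∃ t, (A.advance τ ℓ)^[t] (atState i x) = atState (i + v.length) (A.run τ x v) := by
  induction v generalizing i x with
  | nil => exact ⟨0, rfl⟩
  | cons a v ih =>
    have ha : ℓ i = some a := hv 0 a rfl
    have hfirst : A.advance τ ℓ (atState i x) =
        (x.1.record [(a, A.δ x.2 a)], i + 1, A.δ x.2 a) := by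
      simp [advance, atState, jointMove, next, observe, ha]
    obtain ⟨t, ht⟩ := exists_iterate_advance_resolve (A := A) (τ := τ) ha (A.δ x.2 a)
      (x.1.record [(a, A.δ x.2 a)])
    obtain ⟨t', ht'⟩ := ih (i := i + 1)
      (fun k b hb => by rw [add_right_comm]; exact hv (k + 1) b hb) (A.stepLetter τ x a)
    refine ⟨t' + (t + 1), ?_⟩
    rw [Function.iterate_add_apply, Function.iterate_succ_apply, hfirst, ht, List.length_cons,
      add_comm v.length, ← add_assoc]
    exact ht'

end

/-! ### One player's view of the joint play -/

/-- The stages `x` and `y` of a joint play differ at most in the memory of the opponent of `p`. -/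
def SameView (p : Player) (x y : Memory α Q × (ℕ × PosForm Q)) : Prop :=
  x.1 p = y.1 p ∧ x.2 = y.2

instance (p : Player) : Std.Refl (SameView (α := α) (Q := Q) p) :=
  ⟨fun _ => ⟨rfl, rfl⟩⟩

variable (A) in
/-- The stages `f` form a joint play on `ℓ` as far as `p` can see: the memory of the opponent of `p`
may change arbitrarily between two moves. -/
structure IsJointPlayFor (τ : Player → List (α × PosForm Q) → PosForm Q) (ℓ : ℕ → Option α)
    (p : Player) (f : ℕ → Memory α Q × (ℕ × PosForm Q)) : Prop where
  zero : SameView p (atState 0 (fun _ => [], A.init)) (f 0)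
  succ : ∀ k, SameView p (A.advance τ ℓ (f k)) (f (k + 1))

section

variable {τ : Player → List (α × PosForm Q) → PosForm Q} {ℓ : ℕ → Option α} {p : Player}
  {f : ℕ → Memory α Q × (ℕ × PosForm Q)} {W : Set (ℕ → ℕ × PosForm Q)}

namespace IsJointPlayFor

theorem isPlay (hf : A.IsJointPlayFor τ ℓ p f) : (A.mcGame ℓ W).IsPlay fun k => (f k).2 := by
  refine ⟨hf.zero.2.symm, fun k => ?_⟩
  simp only [← (hf.succ k).2]
  exact A.mcMove_jointMove τ ℓ _ _

theorem memory_eq (hf : A.IsJointPlayFor τ ℓ p f) (k : ℕ) :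
    (f k).1 p = (Game.past (fun n => (f n).2) k ++ [(f k).2]).filterMap (observe ℓ) := by
  induction k with
  | zero => simp [← hf.zero.1, ← hf.zero.2, atState, Game.past, observe]
  | succ k ih =>
    rw [← (hf.succ k).1, ← (hf.succ k).2, Game.past_succ, List.filterMap_append, ← ih]
    simp only [advance, Memory.record]
    cases h : observe ℓ (A.jointMove τ ℓ (f k).1 (f k).2) <;> simp [h]

theorem agrees (hf : A.IsJointPlayFor τ ℓ p f)
    (hτ : (A.mcGame ℓ W).IsStrategy p (A.extend ℓ (τ p))) :
    (A.mcGame ℓ W).Agrees p (A.extend ℓ (τ p)) fun k => (f k).2 := by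
  rintro k rfl
  exact (hf.succ k).2.symm.trans (jointMove_eq_extend (hf.memory_eq k) (hτ _ hf.isPlay k rfl))

end IsJointPlayFor

/-- Exchanging the memory of the opponent of `p` after `u` still gives a play that agrees with the
winning strategy of `p`. -/
theorem exists_play_through_run (hτ : (A.mcGame ℓ W).IsWinning p (A.extend ℓ (τ p)))
    {u : List α} (hu : Reads ℓ 0 u) {x : Memory α Q × Q} (hmem : x.1 p = (A.mainRun τ u).1 p)
    (hstate : x.2 = (A.mainRun τ u).2) :
    ∃ π, (A.mcGame ℓ W).IsPlay π ∧ (A.mcGame ℓ W).WonBy p π ∧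
      ∀ v, Reads ℓ u.length v → ∃ k, π k = (u.length + v.length, .state (A.run τ x v).2) := by
  obtain ⟨t, ht⟩ := exists_iterate_advance_run (A := A) (τ := τ) hu (fun _ => [], A.init)
  obtain ⟨f, hf0, hf, hft⟩ := exists_seq_of_iterate_of_rel (A.advance τ ℓ) (SameView p)
    (y := atState u.length x) (x := atState 0 (fun _ => [], A.init)) (t := t) <| by
      rw [ht, zero_add]
      exact ⟨hmem.symm, congrArg (fun q => (u.length, PosForm.state q)) hstate.symm⟩
  have hjoint : A.IsJointPlayFor τ ℓ p f := ⟨hf0, hf⟩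
  refine ⟨fun k => (f k).2, hjoint.isPlay, hτ.2 _ hjoint.isPlay (hjoint.agrees hτ.1),
    fun v hv => ?_⟩
  obtain ⟨t', ht'⟩ := exists_iterate_advance_run (A := A) (τ := τ) hv x
  exact ⟨t + t', congrArg Prod.snd ((hft t').trans ht')⟩

end

/-! ### Finite words -/

theorem reads_getElem?_left (u v : List α) : Reads (fun i => (u ++ v)[i]?) 0 u := fun k a h => by
  obtain ⟨hk, rfl⟩ := List.getElem?_eq_some_iff.1 h
  simp [List.getElem?_append_left, hk]

theorem reads_getElem?_right (u v : List α) : Reads (fun i => (u ++ v)[i]?) u.length v :=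
  fun k a h => by
    simpa only [List.getElem?_append_right (Nat.le_add_right _ _), Nat.add_sub_cancel_left]

theorem run_mem_acc_iff {τ : Player → List (α × PosForm Q) → PosForm Q} {p : Player}
    {u v : List α}
    (hτ : (A.finGame (u ++ v)).IsWinning p (A.extend (fun i => (u ++ v)[i]?) (τ p)))
    {x : Memory α Q × Q} (hmem : x.1 p = (A.mainRun τ u).1 p)
    (hstate : x.2 = (A.mainRun τ u).2) : (A.run τ x v).2 ∈ A.acc ↔ p = .eve := by
  obtain ⟨π, hplay, hwon, hvisit⟩ :=
    exists_play_through_run hτ (reads_getElem?_left u v) hmem hstate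
  obtain ⟨t, ht⟩ := hvisit v (reads_getElem?_right u v)
  rw [← Game.wonBy_iff.1 hwon]
  constructor
  · exact fun hacc => ⟨t, _, hacc, by rw [ht, List.length_append]⟩
  · rintro ⟨k, q, hq, hk⟩
    rw [List.length_append] at hk
    rwa [state_unique hplay.2 ht hk]

namespace FinGFG

theorem exists_strategies (hA : A.FinGFG) :
    ∃ τ : Player → List (α × PosForm Q) → PosForm Q, ∀ p u, (u ∈ A.finLanguage ↔ p = .eve) →
      (A.finGame u).IsWinning p (A.extend (fun i => u[i]?) (τ p)) := by
  obtain ⟨⟨τE, hE⟩, ⟨τA, hA⟩⟩ := hA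
  refine ⟨fun | .eve => τE | .adam => τA, ?_⟩
  rintro (_ | _) u hu
  exacts [hE u (by simpa using hu), hA u (by simpa using hu)]

theorem exists_leftQuotient_determined (hA : A.FinGFG) :
    ∃ q : List α → Q, ∀ u u', q u = q u' →
      A.finLanguage.leftQuotient u = A.finLanguage.leftQuotient u' := by
  obtain ⟨τ, hτ⟩ := hA.exists_strategies
  have hsub {u u' : List α} (h : (A.mainRun τ u).2 = (A.mainRun τ u').2) {v : List α}
      (hv : u ++ v ∈ A.finLanguage) : u' ++ v ∈ A.finLanguage := by
    by_contra hv'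
    let x : Memory α Q × Q := (.mix (A.mainRun τ u).1 (A.mainRun τ u').1, (A.mainRun τ u).2)
    have heve : (A.run τ x v).2 ∈ A.acc :=
      (run_mem_acc_iff (u := u) (x := x) (hτ .eve _ (by simpa using hv)) rfl rfl).2 rfl
    have hadam := (run_mem_acc_iff (x := x) (hτ .adam _ (by simpa using hv')) rfl h).1 heve
    cases hadam
  exact ⟨fun u => (A.mainRun τ u).2, fun u u' h => Set.ext fun v => ⟨hsub h, hsub h.symm⟩⟩

theorem exists_dfa [Fintype Q] (hA : A.FinGFG) :
    ∃ (Q' : Type) (_ : Fintype Q') (D : DFA α Q'),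
      D.accepts = A.finLanguage ∧ Fintype.card Q' ≤ Fintype.card Q := by
  obtain ⟨q, hq⟩ := hA.exists_leftQuotient_determined
  obtain ⟨n, hn, s₀, d, r, hr⟩ := exists_fin_foldl_eq (fun R a => R.leftQuotient [a])
    A.finLanguage.leftQuotient (fun u a => Language.leftQuotient_append _ u [a]) q hq
  refine ⟨Fin n, inferInstance, ⟨d, s₀, {s | [] ∈ r s}⟩, ?_, by simpa using hn⟩
  ext u
  change [] ∈ r (u.foldl d s₀) ↔ _
  rw [hr, Language.mem_leftQuotient, List.append_nil]

end FinGFG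

/-! ### Infinite words -/

open Stream' in
theorem reads_append_stream_left (u : List α) (y : Stream' α) :
    Reads (fun i => some ((u ++ₛ y).get i)) 0 u := fun k a h => by
  obtain ⟨hk, rfl⟩ := List.getElem?_eq_some_iff.1 h
  simp [get_append_left, hk]

open Stream' in
theorem reads_append_stream_right (u : List α) (y : Stream' α) (n : ℕ) :
    Reads (fun i => some ((u ++ₛ y).get i)) u.length (y.take n) := fun k a h => by
  obtain ⟨hk, rfl⟩ := List.getElem?_eq_some_iff.1 h
  simp

theorem frequently_run_mem_acc_iff {τ : Player → List (α × PosForm Q) → PosForm Q} {p : Player}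
    {u : List α} {y : Stream' α}
    (hτ : (A.infGame (u ++ₛ y)).IsWinning p (A.extend (fun i => some ((u ++ₛ y) i)) (τ p)))
    {x : Memory α Q × Q} (hmem : x.1 p = (A.mainRun τ u).1 p)
    (hstate : x.2 = (A.mainRun τ u).2) :
    (∃ᶠ n in atTop, (A.run τ x (y.take n)).2 ∈ A.acc) ↔ p = .eve := by
  obtain ⟨π, hplay, hwon, hvisit⟩ :=
    exists_play_through_run hτ (reads_append_stream_left u y) hmem hstate
  rw [← Game.wonBy_iff.1 hwon]
  refine (frequently_mem_acc_iff_of_visits (m := u.length) hplay.2 fun n => ?_).symm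
  simpa using hvisit _ (reads_append_stream_right u y n)

variable (A) in
/-- The infinite words that complete `u` to a word in the language. -/
def infResidual (u : List α) : Set (Stream' α) :=
  {y | u ++ₛ y ∈ A.infLanguage}

theorem mem_infResidual {u : List α} {y : Stream' α} :
    y ∈ A.infResidual u ↔ u ++ₛ y ∈ A.infLanguage :=
  Iff.rfl

variable (A) in
/-- `q` behaves like the map that sends a finite word to the state in which the run of two
history-deterministic winning strategies against each other ends. -/
structure IsResolution (q : List α → Q) : Prop where
  reflTransGen_edge : ∀ u v, ReflTransGen A.Edge (q u) (q (u ++ v))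
  frequently_mem_acc_iff : ∀ u y,
    (∃ᶠ n in atTop, q (u ++ y.take n) ∈ A.acc) ↔ y ∈ A.infResidual u
  infResidual_eq : ∀ u u', q u = q u' → A.infResidual u = A.infResidual u'

namespace InfGFG

theorem exists_strategies (hA : A.InfGFG) :
    ∃ τ : Player → List (α × PosForm Q) → PosForm Q, ∀ p w, (w ∈ A.infLanguage ↔ p = .eve) →
      (A.infGame w).IsWinning p (A.extend (fun i => some (w i)) (τ p)) := by
  obtain ⟨⟨τE, hE⟩, ⟨τA, hA⟩⟩ := hA
  refine ⟨fun | .eve => τE | .adam => τA, ?_⟩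
  rintro (_ | _) w hw
  exacts [hE w (by simpa using hw), hA w (by simpa using hw)]

theorem exists_isResolution (hA : A.InfGFG) : ∃ q, A.IsResolution q := by
  obtain ⟨τ, hτ⟩ := hA.exists_strategies
  have hsub {u u' : List α} (h : (A.mainRun τ u).2 = (A.mainRun τ u').2) {y : Stream' α}
      (hy : u ++ₛ y ∈ A.infLanguage) : u' ++ₛ y ∈ A.infLanguage := by
    by_contra hy'
    let x : Memory α Q × Q := (.mix (A.mainRun τ u).1 (A.mainRun τ u').1, (A.mainRun τ u).2)
    have heve : ∃ᶠ n in atTop, (A.run τ x (y.take n)).2 ∈ A.acc :=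
      (frequently_run_mem_acc_iff (u := u) (x := x) (hτ .eve _ (iff_of_true hy rfl)) rfl rfl).2 rfl
    have hadam :=
      (frequently_run_mem_acc_iff (x := x) (hτ .adam _ (iff_of_false hy' nofun)) rfl h).1 heve
    cases hadam
  refine ⟨fun u => (A.mainRun τ u).2, fun u v => ?_, fun u y => ?_,
    fun u u' h => Set.ext fun y => ⟨hsub h, hsub h.symm⟩⟩
  · rw [mainRun_append]
    exact A.reflTransGen_edge_run τ _ v
  · simp only [mainRun_append, mem_infResidual]
    by_cases hy : u ++ₛ y ∈ A.infLanguage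
    · have hp := iff_of_true hy (rfl : Player.eve = .eve)
      exact (frequently_run_mem_acc_iff (hτ .eve _ hp) rfl rfl).trans hp.symm
    · have hp := iff_of_false hy (nofun : Player.adam ≠ .eve)
      exact (frequently_run_mem_acc_iff (hτ .adam _ hp) rfl rfl).trans hp.symm

end InfGFG

section

variable {S : Type*}

/-- The deterministic automaton with transition function `d`, initial state `s₀`, and accepting
states `F`. -/
def ofTransition (d : S → α → S) (s₀ : S) (F : Set S) : AltAutomaton α S where
  init := s₀
  δ s a := .state (d s a)
  acc := F

theorem mem_infLanguage_ofTransition {d : S → α → S} {s₀ : S} {F : Set S} {w : Stream' α} :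
    w ∈ (ofTransition d s₀ F).infLanguage ↔ ∃ᶠ n in atTop, (w.take n).foldl d s₀ ∈ F := by
  refine (Game.wins_iff_of_move_iff (π := fun k => (k, .state ((w.take k).foldl d s₀))) rfl
    (fun k v => ?_) .eve).trans ?_
  · simp only [infGame, mcGame, MCMove, next, ofTransition, Stream'.take_succ', List.foldl_append]
    rfl
  · simp [Game.WonBy, infGame, mcGame, ofTransition]

/-- `t` can be reached from `s` by reading some word with the transition function `d`. -/
def Reaches (d : S → α → S) (s t : S) : Prop :=
  ∃ v : List α, v.foldl d s = t

instance (d : S → α → S) : IsPreorder S (Reaches d) where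
  refl _ := ⟨[], rfl⟩
  trans := by
    rintro s _ _ ⟨u, rfl⟩ ⟨v, rfl⟩
    exact ⟨u ++ v, List.foldl_append⟩

theorem reaches_of_reflTransGen_edge {d : S → α → S} {s₀ : S} {F : Set S} {s t : S}
    (h : ReflTransGen (ofTransition d s₀ F).Edge s t) : Reaches d s t := by
  induction h with
  | refl => exact refl s
  | tail _ hedge ih =>
    obtain ⟨a, rfl⟩ := hedge
    exact _root_.trans ih ⟨[a], rfl⟩

/-! ### Weak automata -/

/-- Among the words that lead with the transition function `d` to the strongly connected component
of `u`, the state `q u` is as far in the graph of `A` as possible. -/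
def IsTerminal (A : AltAutomaton α Q) (q : List α → Q) (d : S → α → S) (s₀ : S) (u : List α) :
    Prop :=
  ∀ v, AntisymmRel (Reaches d) (u.foldl d s₀) (v.foldl d s₀) →
    ReflTransGen A.Edge (q u) (q v) → ReflTransGen A.Edge (q v) (q u)

theorem exists_isTerminal [Finite Q] (q : List α → Q) (d : S → α → S) (s₀ : S) (u : List α) :
    ∃ v, AntisymmRel (Reaches d) (v.foldl d s₀) (u.foldl d s₀) ∧ A.IsTerminal q d s₀ v := by
  obtain ⟨v, hv, hmax⟩ := exists_mem_forall_rel_symm (ReflTransGen A.Edge) q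
    (T := {v | AntisymmRel (Reaches d) (v.foldl d s₀) (u.foldl d s₀)}) ⟨u, .rfl⟩
  exact ⟨v, hv, fun v' h => hmax v' (h.symm.trans hv)⟩

theorem exists_forall_antisymmRel_foldl_take [Finite S] (d : S → α → S) (s₀ : S)
    (w : Stream' α) : ∃ N, ∀ n,
      AntisymmRel (Reaches d) ((w.take N).foldl d s₀) ((w.take (N + n)).foldl d s₀) := by
  obtain ⟨N, -, hN⟩ := exists_mem_forall_rel_symm (Reaches d) (fun n => (w.take n).foldl d s₀)
    Set.univ_nonempty
  have hreach (n : ℕ) : Reaches d ((w.take N).foldl d s₀) ((w.take (N + n)).foldl d s₀) :=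
    ⟨(w.drop N).take n, by rw [Stream'.take_add, List.foldl_append]⟩
  exact ⟨N, fun n => ⟨hreach n, hN _ trivial (hreach n)⟩⟩

theorem IsTerminal.mem_infLanguage_iff {q : List α → Q} {d : S → α → S} {s₀ : S} {u : List α}
    (hu : A.IsTerminal q d s₀ u) (hweak : A.IsWeak) (hq : A.IsResolution q)
    {r : S → Set (Stream' α)} (hr : ∀ u : List α, r (u.foldl d s₀) = A.infResidual u)
    {w : Stream' α} {N : ℕ} (huw : AntisymmRel (Reaches d) (u.foldl d s₀) ((w.take N).foldl d s₀))
    (hw : ∀ n, AntisymmRel (Reaches d) ((w.take N).foldl d s₀) ((w.take (N + n)).foldl d s₀)) :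
    w ∈ A.infLanguage ↔ q u ∈ A.acc := by
  obtain ⟨z, hz⟩ := huw.1
  have hacc (n : ℕ) : q (u ++ z ++ (w.drop N).take n) ∈ A.acc ↔ q u ∈ A.acc := by
    have hfold : (u ++ (z ++ (w.drop N).take n)).foldl d s₀ = (w.take (N + n)).foldl d s₀ := by
      rw [List.foldl_append, List.foldl_append, hz, Stream'.take_add, List.foldl_append]
    have hedge := hq.reflTransGen_edge u (z ++ (w.drop N).take n)
    rw [List.append_assoc]
    exact hweak _ _ (hu _ (hfold ▸ huw.trans (hw n)) hedge) hedge
  calc w ∈ A.infLanguage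
    _ ↔ w.drop N ∈ A.infResidual (w.take N) := by
      rw [mem_infResidual, Stream'.append_take_drop]
    _ ↔ w.drop N ∈ A.infResidual (u ++ z) := by rw [← hr, ← hr, List.foldl_append, hz]
    _ ↔ ∃ᶠ n in atTop, q (u ++ z ++ (w.drop N).take n) ∈ A.acc :=
      (hq.frequently_mem_acc_iff _ _).symm
    _ ↔ q u ∈ A.acc := by simp only [hacc, frequently_const]

/-- The states whose strongly connected component contains the end of the run on a terminal word
that is sent by `q` to an accepting state of `A`. -/
def terminalAcc (A : AltAutomaton α Q) (q : List α → Q) (d : S → α → S) (s₀ : S) : Set S :=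
  {s | ∃ u : List α, AntisymmRel (Reaches d) (u.foldl d s₀) s ∧ A.IsTerminal q d s₀ u ∧
    q u ∈ A.acc}

theorem isWeak_ofTransition_terminalAcc (q : List α → Q) (d : S → α → S) (s₀ : S) :
    (ofTransition d s₀ (A.terminalAcc q d s₀)).IsWeak := by
  have hsub {s t : S} (h : AntisymmRel (Reaches d) s t) :
      s ∈ A.terminalAcc q d s₀ → t ∈ A.terminalAcc q d s₀ :=
    fun ⟨u, hus, hu⟩ => ⟨u, hus.trans h, hu⟩
  intro s t hst hts
  have h : AntisymmRel (Reaches d) s t :=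
    ⟨reaches_of_reflTransGen_edge hst, reaches_of_reflTransGen_edge hts⟩
  exact ⟨hsub h, hsub h.symm⟩

theorem infLanguage_ofTransition_terminalAcc [Finite Q] [Finite S] (hweak : A.IsWeak)
    {q : List α → Q} (hq : A.IsResolution q) {d : S → α → S} {s₀ : S}
    {r : S → Set (Stream' α)} (hr : ∀ u : List α, r (u.foldl d s₀) = A.infResidual u) :
    (ofTransition d s₀ (A.terminalAcc q d s₀)).infLanguage = A.infLanguage := by
  refine Set.ext fun (w : Stream' α) => mem_infLanguage_ofTransition.trans ?_
  obtain ⟨N, hN⟩ := exists_forall_antisymmRel_foldl_take d s₀ w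
  have hmem (n : ℕ) : ((Stream'.take (N + n) w).foldl d s₀ ∈ A.terminalAcc q d s₀) ↔
      w ∈ A.infLanguage := by
    constructor
    · rintro ⟨u, hus, hu, hacc⟩
      exact (hu.mem_infLanguage_iff hweak hq hr (hus.trans (hN n).symm) hN).2 hacc
    · intro hw
      obtain ⟨u, hus, hu⟩ := exists_isTerminal (A := A) q d s₀ (Stream'.take N w)
      exact ⟨u, hus.trans (hN n), hu, (hu.mem_infLanguage_iff hweak hq hr hus hN).1 hw⟩
  refine (frequently_congr ?_).trans (frequently_const (f := atTop (α := ℕ)))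
  filter_upwards [eventually_ge_atTop N] with n hn
  obtain ⟨n, rfl⟩ := Nat.exists_eq_add_of_le hn
  exact hmem n

end

theorem InfGFG.exists_dww [Fintype Q] (hA : A.InfGFG) (hweak : A.IsWeak) :
    ∃ (Q' : Type) (_ : Fintype Q') (D : AltAutomaton α Q'),
      D.IsDeterministic ∧ D.IsWeak ∧ D.infLanguage = A.infLanguage ∧
        Fintype.card Q' ≤ Fintype.card Q := by
  obtain ⟨q, hq⟩ := hA.exists_isResolution
  obtain ⟨n, hn, s₀, d, r, hr⟩ := exists_fin_foldl_eq (fun R a => {y | [a] ++ₛ y ∈ R})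
    A.infResidual (fun u a => by ext y; simp [infResidual]) q hq.infResidual_eq
  exact ⟨Fin n, inferInstance, ofTransition d s₀ (A.terminalAcc q d s₀), fun s a => ⟨d s a, rfl⟩,
    isWeak_ofTransition_terminalAcc q d s₀, infLanguage_ofTransition_terminalAcc hweak hq hr,
    by simpa using hn⟩

end AltAutomaton

theorem mainTheorem4_general {α Q : Type*} [Fintype Q] (A : AltAutomaton α Q) :
    (A.FinGFG →
      ∃ (Q' : Type) (_ : Fintype Q') (D : DFA α Q'),
        D.accepts = A.finLanguage ∧ Fintype.card Q' ≤ Fintype.card Q) ∧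
    (A.IsWeak → A.InfGFG →
      ∃ (Q' : Type) (_ : Fintype Q') (D : AltAutomaton α Q'),
        D.IsDeterministic ∧ D.IsWeak ∧ D.infLanguage = A.infLanguage ∧
          Fintype.card Q' ≤ Fintype.card Q) :=
  ⟨fun hA => hA.exists_dfa, fun hweak hA => hA.exists_dww hweak⟩

theorem mainTheorem4 {α Q : Type*} [Finite α] [Nonempty α] [Fintype Q] (A : AltAutomaton α Q) :
    (A.FinGFG →
      ∃ (Q' : Type) (_ : Fintype Q') (D : DFA α Q'),
        D.accepts = A.finLanguage ∧ Fintype.card Q' ≤ Fintype.card Q) ∧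
    (A.IsWeak → A.InfGFG →
      ∃ (Q' : Type) (_ : Fintype Q') (D : AltAutomaton α Q'),
        D.IsDeterministic ∧ D.IsWeak ∧ D.infLanguage = A.infLanguage ∧
          Fintype.card Q' ≤ Fintype.card Q) :=
  mainTheorem4_general A
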